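/- Let $k,m,n_1,\dots,n_k$ be nonnegative integers, let $H_1,\dots,H_k$ be independent random matrices, $H_i$ of size $m\times n_i$ with i.i.d. zero-mean unit-variance circularly symmetric complex Gaussian entries, and consider the coherent MIMO Rician multiple-access channel with output $(H_1,\dots,H_k,Y)$, $Y=\sum_{i=1}^k (H_i+D_i)x_i+Z$, where $D_i\in\mathbb C^{m\times n_i}$ are deterministic line-of-sight (LOS) matrices and $Z\sim\mathcal N_{\mathbb C}(0,I_m)$ is independent of the $H_i$. For positive semidefinite Hermitian $K_i\in\mathbb C^{n_i\times n_i}$ let $\mathcal R(K_1,\dots,K_k;D_1,\dots,D_k)$ be the set of all rate vectors $(R_1,\dots,R_k)\in\mathbb R^k$ such that $$\sum_{i\in S}R_i\le \mathbb E\Bigl[\log\det\Bigl(I_m+\sum_{i\in S}(H_i+D_i)K_i(H_i+D_i)^*\Bigr)\Bigr]\qquad\text{for all } S\subseteq\{1,\dots,k\},$$ and for $\mathcal E_1,\dots,\mathcal E_k\in\mathbb R$ let the capacity region be $$\mathcal C(\mathcal E_1,\dots,\mathcal E_k;D_1,\dots,D_k)=\bigcup\,\mathcal R(K_1,\dots,K_k;D_1,\dots,D_k),$$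 the union being over all positive semidefinite $K_1,\dots,K_k$ with $\operatorname{tr}K_i\le\mathcal E_i$ for every $i$. Let $D_i,\tilde D_i\in\mathbb C^{m\times n_i}$ and $\tilde D=[\tilde D_1,\dots,\tilde D_k]$, and suppose that for some unitary $U_i\in\mathbb C^{n_i\times n_i}$, $i=1,\dots,k$, the matrix $$[D_1U_1,\dots,D_kU_k]^*[D_1U_1,\dots,D_kU_k]-\tilde D^*\tilde D$$ is positive semidefinite. Then $$\mathcal C(\mathcal E_1,\dots,\mathcal E_k;D_1,\dots,D_k)\supseteq\mathcal C(\mathcal E_1,\dots,\mathcal E_k;\tilde D_1,\dots,\tilde D_k).$$ -/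

import Mathlib

namespace RicianMAC

open MeasureTheory ProbabilityTheory
open scoped NNReal Matrix ComplexOrder

/-- The zero-mean, unit-variance circularly symmetric complex Gaussian law: the real and
imaginary parts are independent real Gaussians of mean `0` and variance `1 / 2`. -/
noncomputable def stdComplexGaussian : Measure ℂ :=
  ((gaussianReal 0 (1 / 2)).prod (gaussianReal 0 (1 / 2))).map
    (fun p : ℝ × ℝ => (⟨p.1, p.2⟩ : ℂ))

instance : IsProbabilityMeasure stdComplexGaussian :=
  Measure.isProbabilityMeasure_map Complex.measurableEquivRealProd.symm.measurable.aemeasurable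

/-- The joint law of the fading matrices `H₁, …, H_k`, where `H_i` is `m × n_i`: all entries of
all the matrices are independent and have the law `stdComplexGaussian`. -/
noncomputable def fadingLaw {k : ℕ} (m : ℕ) (n : Fin k → ℕ) :
    Measure (∀ i : Fin k, Fin m → Fin (n i) → ℂ) :=
  Measure.pi fun _ => Measure.pi fun _ => Measure.pi fun _ => stdComplexGaussian

/-- `E[log det (I_m + ∑_{i ∈ S} (H_i + D_i) K_i (H_i + D_i)ᴴ)]`. For positive semidefinite `K_i`
the determinant is a real number, at least `1`, and its logarithm is integrable. -/
noncomputable def gaussianRate {k m : ℕ} {n : Fin k → ℕ}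
    (K : ∀ i, Matrix (Fin (n i)) (Fin (n i)) ℂ) (D : ∀ i, Matrix (Fin m) (Fin (n i)) ℂ)
    (S : Finset (Fin k)) : ℝ :=
  ∫ H, Real.log (Matrix.det ((1 : Matrix (Fin m) (Fin m) ℂ) +
      ∑ i ∈ S, (Matrix.of (H i) + D i) * K i * (Matrix.of (H i) + D i)ᴴ)).re ∂(fadingLaw m n)

/-- The rate region achieved by independent Gaussian inputs with covariance matrices `K_i` over
the multiple-access channel with LOS matrices `D_i`. -/
def rateRegion {k m : ℕ} {n : Fin k → ℕ}
    (K : ∀ i, Matrix (Fin (n i)) (Fin (n i)) ℂ) (D : ∀ i, Matrix (Fin m) (Fin (n i)) ℂ) :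
    Set (Fin k → ℝ) :=
  {R | ∀ S : Finset (Fin k), ∑ i ∈ S, R i ≤ gaussianRate K D S}

/-- The capacity region of the multiple-access channel with LOS matrices `D_i` and input power
constraints `E_i`: the union of the rate regions over all input covariance matrices `K_i` with
`tr K_i ≤ E_i`. -/
def capacityRegion {k m : ℕ} {n : Fin k → ℕ} (E : Fin k → ℝ)
    (D : ∀ i, Matrix (Fin m) (Fin (n i)) ℂ) : Set (Fin k → ℝ) :=
  {R | ∃ K : ∀ i, Matrix (Fin (n i)) (Fin (n i)) ℂ,
    (∀ i, (K i).PosSemidef ∧ (K i).trace.re ≤ E i) ∧ R ∈ rateRegion K D}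

/-- The block matrix `[A₁, …, A_k]`. -/
def blockRow {k m : ℕ} {n : Fin k → ℕ} (A : ∀ i, Matrix (Fin m) (Fin (n i)) ℂ) :
    Matrix (Fin m) (Σ i, Fin (n i)) ℂ :=
  Matrix.of fun r c => A c.1 r c.2

end RicianMAC

namespace RicianMAC
open MeasureTheory ProbabilityTheory
open scoped NNReal ENNReal Matrix ComplexOrder Kronecker

/-! Replacing `K i` by `U i * K i * (U i)ᴴ` keeps the trace, and since `H i` and `H i * U i` have
the same law it acts on the rates as `D i ↦ D i * U i` (`gaussianRate_conj_unitary`). It therefore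
suffices that, for fixed covariances, each rate is monotone in the Gram matrix of the block LOS
matrix (`gaussianRate_mono`). Collecting the users of `S` into one block-diagonal `K` turns this
into a claim about `E log det (1 + (H + A) K (H + A)ᴴ)` with a single Gaussian matrix `H` and mean
`A`.

If `Bᴴ B ≤ Aᴴ A`, then `B = W A` with a contraction `W`, whose singular value decomposition is a
unitary times a diagonal matrix with entries in `[0, 1]` times a unitary
(`exists_eq_unitary_mul_diagonal`). The unitary factors disappear by invariance of the Gaussian law
and of the determinant, so only the shrinking of rows of the mean has to be examined.

With the other rows frozen, the determinant is affine with nonnegative coefficients in the squared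
moduli of the unitary coordinates of the remaining row (`exists_det_updateRow`), and these
coordinates are again independent Gaussians. What is left is scalar: moving a centred real Gaussian
away from the origin increases the mean of a function that increases in `|x|`
(`lintegral_gaussianReal_add_mono`). Applying it one coordinate at a time (`lintegral_pi_mono`)
gives the result, with expectations taken in `[0, ∞]` and finite by a trace bound. -/

/-! ### Translates of Gaussian measures and coordinatewise comparison of integrals. -/

/-- The density of a centred real Gaussian decreases with the distance from the origin. -/
lemma gaussianPDF_zero_le_of_abs_le {v : ℝ≥0} {x y : ℝ} (h : |x| ≤ |y|) :
    gaussianPDF 0 v y ≤ gaussianPDF 0 v x := by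
  refine ENNReal.ofReal_le_ofReal ?_
  simp only [gaussianPDFReal, sub_zero]
  have := sq_le_sq.2 h
  gcongr

/-- The two-term rearrangement inequality: the sides differ by `(b - a) * (d - c)`, written with
additive increments because subtraction in `ℝ≥0∞` truncates. -/
lemma ennreal_mul_add_mul_le {a b c d : ℝ≥0∞} (hab : a ≤ b) (hcd : c ≤ d) :
    b * c + a * d ≤ a * c + b * d := by
  obtain ⟨u, rfl⟩ := exists_add_of_le hab
  obtain ⟨w, rfl⟩ := exists_add_of_le hcd
  calc (a + u) * c + a * (c + w) ≤ (a + u) * c + a * (c + w) + u * w := le_self_add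
    _ = _ := by ring

/-- Translating a centred real Gaussian further away from the origin increases the integral of a
function that increases with the distance from the origin. -/
lemma lintegral_gaussianReal_add_mono {v : ℝ≥0} (hv : v ≠ 0) {f : ℝ → ℝ≥0∞} (hf : Measurable f)
    (hmono : ∀ x y, |x| ≤ |y| → f x ≤ f y) {c d : ℝ} (hcd : |d| ≤ |c|) :
    ∫⁻ x, f (x + d) ∂gaussianReal 0 v ≤ ∫⁻ x, f (x + c) ∂gaussianReal 0 v := by
  have hp : Measurable (gaussianPDF 0 v) := measurable_gaussianPDF 0 v
  have heven : ∀ x, f (-x) = f x := fun x ↦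
    le_antisymm (hmono _ _ (abs_neg x).le) (hmono _ _ (abs_neg x).ge)
  have hpeven : ∀ x, gaussianPDF 0 v (-x) = gaussianPDF 0 v x := fun x ↦
    le_antisymm (gaussianPDF_zero_le_of_abs_le (abs_neg x).ge)
      (gaussianPDF_zero_le_of_abs_le (abs_neg x).le)
  -- Centring at the midpoint `s` turns the two translates of `f` into `f (y + δ)` and `f (y - δ)`
  -- against the same density at `y - s`. Reflecting `y` gives a second formula with the density at
  -- `y + s`; the sum of the two can be compared pointwise by rearrangement.
  set δ := (c - d) / 2 with hδ
  set s := (c + d) / 2 with hs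
  have key : ∀ e : ℝ, ∫⁻ x, f (x + e) ∂gaussianReal 0 v =
      ∫⁻ y, gaussianPDF 0 v (y - s) * f (y + (e - s)) := by
    intro e
    rw [gaussianReal_of_var_ne_zero _ hv, lintegral_withDensity_eq_lintegral_mul _ hp (by fun_prop),
      ← lintegral_add_right_eq_self _ (-s)]
    refine lintegral_congr fun y ↦ ?_
    simp only [Pi.mul_apply]
    congr 2
    ring
  have key' : ∀ e : ℝ, ∫⁻ x, f (x + e) ∂gaussianReal 0 v =
      ∫⁻ y, gaussianPDF 0 v (y + s) * f (y - (e - s)) := by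
    intro e
    rw [key, ← lintegral_neg_eq_self]
    refine lintegral_congr fun y ↦ ?_
    rw [← hpeven, ← heven]
    congr 2 <;> ring
  have hprod : δ * s = (c ^ 2 - d ^ 2) / 4 := by rw [hδ, hs]; ring
  have hprod0 : 0 ≤ δ * s := by
    rw [hprod]; have := sq_le_sq.2 hcd; linarith
  have two : ∀ e : ℝ, 2 * ∫⁻ x, f (x + e) ∂gaussianReal 0 v =
      ∫⁻ y, (gaussianPDF 0 v (y - s) * f (y + (e - s)) +
        gaussianPDF 0 v (y + s) * f (y - (e - s))) := by
    intro e
    rw [lintegral_add_left (by fun_prop), ← key, ← key', two_mul]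
  rw [← ENNReal.mul_le_mul_iff_right (a := 2) (by simp) (by simp), two, two]
  refine lintegral_mono fun y ↦ ?_
  have e1 : c - s = δ := by rw [hδ, hs]; ring
  have e2 : d - s = -δ := by rw [hδ, hs]; ring
  simp only [e1, e2, sub_neg_eq_add, ← sub_eq_add_neg]
  have hsq : ∀ a b : ℝ, |a - b| ≤ |a + b| ↔ 0 ≤ a * b := fun a b ↦ by
    rw [← sq_le_sq]; constructor <;> intro h <;> nlinarith
  have hsq' : ∀ a b : ℝ, |a + b| ≤ |a - b| ↔ a * b ≤ 0 := fun a b ↦ by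
    rw [← sq_le_sq]; constructor <;> intro h <;> nlinarith
  -- The product of `y * s` and `y * δ` is `y ^ 2 * (δ * s) ≥ 0`, so opposite signs force one of
  -- them to vanish. Hence density and `f` order the points `y ± s` and `y ± δ` compatibly.
  have sameSign : (0 ≤ y * s ∧ 0 ≤ y * δ) ∨ (y * s ≤ 0 ∧ y * δ ≤ 0) := by
    rcases le_total 0 (y * s) with h | h <;> rcases le_total 0 (y * δ) with h' | h'
    · exact Or.inl ⟨h, h'⟩
    · have : y * s * (y * δ) ≤ 0 := mul_nonpos_of_nonneg_of_nonpos h h'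
      have h0 : y * s * (y * δ) = 0 := le_antisymm this (by nlinarith [mul_nonneg (sq_nonneg y) hprod0])
      rcases mul_eq_zero.1 h0 with h0 | h0
      · exact Or.inr ⟨h0.le, h'⟩
      · exact Or.inl ⟨h, h0.ge⟩
    · have : y * s * (y * δ) ≤ 0 := mul_nonpos_of_nonpos_of_nonneg h h'
      have h0 : y * s * (y * δ) = 0 := le_antisymm this (by nlinarith [mul_nonneg (sq_nonneg y) hprod0])
      rcases mul_eq_zero.1 h0 with h0 | h0
      · exact Or.inl ⟨h0.ge, h'⟩
      · exact Or.inr ⟨h, h0.le⟩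
    · exact Or.inr ⟨h, h'⟩
  rcases sameSign with ⟨h, h'⟩ | ⟨h, h'⟩
  · have := ennreal_mul_add_mul_le
      (gaussianPDF_zero_le_of_abs_le (v := v) ((hsq y s).2 h)) (hmono _ _ ((hsq y δ).2 h'))
    rwa [add_comm (_ * f (y + δ))]
  · have := ennreal_mul_add_mul_le
      (gaussianPDF_zero_le_of_abs_le (v := v) ((hsq' y s).2 h)) (hmono _ _ ((hsq' y δ).2 h'))
    rwa [add_comm]

/-- The complex version of `lintegral_gaussianReal_add_mono`. -/
lemma lintegral_stdComplexGaussian_add_mono {f : ℂ → ℝ≥0∞} (hf : Measurable f)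
    (hmono : ∀ z w : ℂ, |z.re| ≤ |w.re| → |z.im| ≤ |w.im| → f z ≤ f w) {c d : ℂ}
    (hre : |d.re| ≤ |c.re|) (him : |d.im| ≤ |c.im|) :
    ∫⁻ z, f (z + d) ∂stdComplexGaussian ≤ ∫⁻ z, f (z + c) ∂stdComplexGaussian := by
  have hmk : Measurable fun p : ℝ × ℝ ↦ (⟨p.1, p.2⟩ : ℂ) :=
    Complex.measurableEquivRealProd.symm.measurable
  have expand : ∀ e : ℂ, ∫⁻ z, f (z + e) ∂stdComplexGaussian =
      ∫⁻ x, ∫⁻ y, f ⟨x + e.re, y + e.im⟩ ∂gaussianReal 0 (1 / 2) ∂gaussianReal 0 (1 / 2) := by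
    intro e
    rw [stdComplexGaussian, lintegral_map (by fun_prop) hmk, lintegral_prod]
    · rfl
    · exact (hf.comp ((measurable_add_const e).comp hmk)).aemeasurable
  have half : (1 / 2 : ℝ≥0) ≠ 0 := by simp
  rw [expand, expand]
  have meas : Measurable fun p : ℝ × ℝ ↦ f ⟨p.1, p.2⟩ := hf.comp hmk
  calc _ ≤ ∫⁻ x, ∫⁻ y, f ⟨x + d.re, y + c.im⟩ ∂gaussianReal 0 (1 / 2) ∂gaussianReal 0 (1 / 2) := by
        refine lintegral_mono fun x ↦ ?_
        exact lintegral_gaussianReal_add_mono half (f := fun y ↦ f ⟨x + d.re, y⟩)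
          (meas.comp measurable_prodMk_left) (fun a b h ↦ hmono _ _ le_rfl h) him
    _ ≤ _ := by
        refine lintegral_gaussianReal_add_mono half
          (f := fun x ↦ ∫⁻ y, f ⟨x, y + c.im⟩ ∂gaussianReal 0 (1 / 2)) ?_ ?_ hre
        · exact Measurable.lintegral_prod_right'
            (f := fun p : ℝ × ℝ ↦ f ⟨p.1, p.2 + c.im⟩) (meas.comp (by fun_prop : Measurable
              fun p : ℝ × ℝ ↦ (p.1, p.2 + c.im)))
        · exact fun a b h ↦ lintegral_mono fun y ↦ hmono _ _ h le_rfl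

/-- Integrals against product measures can be compared one coordinate at a time. -/
lemma lintegral_pi_mono {ι : Type*} [Fintype ι] [DecidableEq ι] {X : ι → Type*}
    [∀ i, MeasurableSpace (X i)] (μ ν : ∀ i, Measure (X i)) [∀ i, SigmaFinite (μ i)]
    [∀ i, SigmaFinite (ν i)] {F : (∀ i, X i) → ℝ≥0∞} (hF : Measurable F)
    (h : ∀ i x, ∫⁻ y, F (Function.update x i y) ∂μ i ≤ ∫⁻ y, F (Function.update x i y) ∂ν i) :
    ∫⁻ x, F x ∂Measure.pi μ ≤ ∫⁻ x, F x ∂Measure.pi ν := by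
  -- Hybrid argument: the factors `μ i` are exchanged for `ν i` one index at a time.
  suffices H : ∀ s : Finset ι, ∫⁻ x, F x ∂Measure.pi μ ≤
      ∫⁻ x, F x ∂Measure.pi (fun i ↦ if i ∈ s then ν i else μ i) by
    simpa using H Finset.univ
  intro s
  induction s using Finset.induction_on with
  | empty => simp
  | insert i s hi ih =>
    refine ih.trans ?_
    have (t : Finset ι) (j : ι) : SigmaFinite (if j ∈ t then ν j else μ j) := by
      split_ifs <;> infer_instance
    rcases isEmpty_or_nonempty (∀ i, X i) with hX | ⟨⟨x₀⟩⟩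
    · simp [Measure.eq_zero_of_isEmpty]
    -- Integrating over coordinate `i` innermost lets `h i` apply; on the remaining coordinates the
    -- two product measures agree.
    rw [lintegral_eq_lmarginal_univ x₀, lintegral_eq_lmarginal_univ x₀,
      lmarginal_erase' _ hF (Finset.mem_univ i), lmarginal_erase' _ hF (Finset.mem_univ i)]
    simp only [hi, if_false, Finset.mem_insert_self, if_true]
    refine (lmarginal_mono (fun x ↦ h i x) x₀).trans_eq ?_
    simp only [lmarginal]
    congr 1
    congr 1
    ext1 ⟨j, hj⟩
    have : j ≠ i := Finset.ne_of_mem_erase hj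
    simp [this]

/-! ### Unitary invariance of Gaussian vectors and matrices. -/

lemma charFun_stdComplexGaussian (t : ℂ) :
    charFun stdComplexGaussian t = Complex.exp (-‖t‖ ^ 2 / 4) := by
  have hmk : Measurable fun p : ℝ × ℝ ↦ (⟨p.1, p.2⟩ : ℂ) :=
    Complex.measurableEquivRealProd.symm.measurable
  rw [charFun_apply, stdComplexGaussian, integral_map hmk.aemeasurable (by fun_prop)]
  have : ∀ p : ℝ × ℝ, Complex.exp ((inner ℝ (⟨p.1, p.2⟩ : ℂ) t : ℝ) * Complex.I) =
      Complex.exp (t.re * p.1 * Complex.I) * Complex.exp (t.im * p.2 * Complex.I) := by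
    intro p
    rw [← Complex.exp_add]
    congr 1
    simp [Complex.inner]
    ring
  simp_rw [this]
  rw [integral_prod_mul (fun x : ℝ ↦ Complex.exp (t.re * x * Complex.I))
    (fun x : ℝ ↦ Complex.exp (t.im * x * Complex.I)), ← charFun_apply_real, ← charFun_apply_real,
    charFun_gaussianReal, charFun_gaussianReal, ← Complex.exp_add]
  congr 1
  have : ((‖t‖ : ℂ)) ^ 2 = t.re ^ 2 + t.im ^ 2 := by
    rw [← Complex.ofReal_pow, Complex.sq_norm, Complex.normSq_apply]; push_cast; ring
  rw [this]
  push_cast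
  ring

/-- The law of a vector of independent standard complex Gaussians. -/
noncomputable abbrev gaussianVec (ι : Type*) [Fintype ι] : Measure (ι → ℂ) :=
  Measure.pi fun _ ↦ stdComplexGaussian

/-- The law of a matrix of independent standard complex Gaussians. -/
noncomputable abbrev gaussianMat (m ι : Type*) [Fintype m] [Fintype ι] : Measure (m → ι → ℂ) :=
  Measure.pi fun _ ↦ gaussianVec ι

/-- The characteristic function depends on `‖t‖` only, which is what makes the law unitarily
invariant. -/
lemma charFun_gaussianVec {ι : Type*} [Fintype ι] (t : EuclideanSpace ℂ ι) :
    charFun ((gaussianVec ι).map (WithLp.toLp 2)) t = Complex.exp (-‖t‖ ^ 2 / 4) := by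
  rw [charFun_pi]
  simp_rw [charFun_stdComplexGaussian, ← Complex.exp_sum, ← Complex.ofReal_pow,
    EuclideanSpace.norm_sq_eq]
  simp [Finset.sum_div, neg_div]

/-- Circular symmetry: a vector of independent standard complex Gaussians is invariant under
unitary transformations. -/
lemma measurePreserving_mulVec {ι : Type*} [Fintype ι] [DecidableEq ι] {U : Matrix ι ι ℂ}
    (hU : U ∈ Matrix.unitaryGroup ι ℂ) :
    MeasurePreserving (fun h ↦ U *ᵥ h) (gaussianVec ι) (gaussianVec ι) := by
  have hm : Measurable fun h : ι → ℂ ↦ U *ᵥ h := by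
    exact (Continuous.matrix_mulVec continuous_const continuous_id).measurable
  have := Measure.isProbabilityMeasure_map (μ := gaussianVec ι) hm.aemeasurable
  refine ⟨hm, charFun_eq_pi_iff.1 fun t ↦ ?_⟩
  rw [← charFun_pi, charFun_gaussianVec, Measure.map_map (by fun_prop) hm, charFun_apply,
    integral_map (by fun_prop) (by fun_prop)]
  -- The unitary moves to the other side of the inner product as `Uᴴ`, and `Uᴴ` preserves the norm
  -- of `t`.
  have key : ∀ h : ι → ℂ, inner ℝ ((WithLp.toLp 2 ∘ fun h ↦ U *ᵥ h) h : EuclideanSpace ℂ ι) t =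
      inner ℝ (WithLp.toLp 2 h) (WithLp.toLp 2 (Uᴴ *ᵥ t.ofLp) : EuclideanSpace ℂ ι) := by
    intro h
    have hre : ∀ x y : EuclideanSpace ℂ ι, inner ℝ x y = (star x.ofLp ⬝ᵥ y.ofLp).re := fun x y ↦ by
      simp [PiLp.inner_apply, Complex.inner, dotProduct, mul_comm]
    rw [hre, hre]
    simp only [Function.comp]
    rw [Matrix.star_mulVec, ← Matrix.dotProduct_mulVec]
  simp_rw [key]
  have : ∫ h, Complex.exp ((inner ℝ (WithLp.toLp 2 h)
      (WithLp.toLp 2 (Uᴴ *ᵥ t.ofLp) : EuclideanSpace ℂ ι) : ℝ) * Complex.I) ∂gaussianVec ι =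
      charFun ((gaussianVec ι).map (WithLp.toLp 2)) (WithLp.toLp 2 (Uᴴ *ᵥ t.ofLp)) := by
    rw [charFun_apply, integral_map (by fun_prop) (by fun_prop)]
  rw [this, charFun_gaussianVec]
  congr 3
  rw [← Complex.ofReal_pow, ← Complex.ofReal_pow]
  congr 1
  rw [← RCLike.ofReal_inj (K := ℂ), RCLike.ofReal_pow, RCLike.ofReal_pow,
    ← inner_self_eq_norm_sq_to_K, ← inner_self_eq_norm_sq_to_K]
  simp only [EuclideanSpace.inner_eq_star_dotProduct]
  rw [Matrix.star_mulVec, dotProduct_comm, ← Matrix.dotProduct_mulVec, Matrix.mulVec_mulVec,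
    Matrix.conjTranspose_conjTranspose]
  have : U * Uᴴ = 1 := Matrix.mem_unitaryGroup_iff.1 hU
  rw [this, Matrix.one_mulVec, dotProduct_comm]

lemma measurePreserving_vecMul {ι : Type*} [Fintype ι] [DecidableEq ι] {U : Matrix ι ι ℂ}
    (hU : U ∈ Matrix.unitaryGroup ι ℂ) :
    MeasurePreserving (fun h ↦ h ᵥ* U) (gaussianVec ι) (gaussianVec ι) := by
  have hU' : Uᵀ ∈ Matrix.unitaryGroup ι ℂ := by
    rw [Matrix.mem_unitaryGroup_iff']
    have : U * star U = 1 := Matrix.mem_unitaryGroup_iff.1 hU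
    rw [Matrix.star_eq_conjTranspose] at this ⊢
    change Uᴴᵀ * Uᵀ = 1
    rw [← Matrix.transpose_mul, this, Matrix.transpose_one]
  simpa only [Matrix.mulVec_transpose] using measurePreserving_mulVec hU'

lemma measurePreserving_uncurry (m ι : Type*) [Fintype m] [Fintype ι] :
    MeasurePreserving (fun (H : m → ι → ℂ) p ↦ H p.1 p.2) (gaussianMat m ι)
      (gaussianVec (m × ι)) := by
  have hm : Measurable fun (H : m → ι → ℂ) (p : m × ι) ↦ H p.1 p.2 := by fun_prop
  refine ⟨hm, (Measure.pi_eq fun s hs ↦ ?_).symm⟩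
  rw [Measure.map_apply hm (.univ_pi hs)]
  have : (fun (H : m → ι → ℂ) (p : m × ι) ↦ H p.1 p.2) ⁻¹' Set.univ.pi s =
      Set.univ.pi fun r ↦ Set.univ.pi fun c ↦ s (r, c) := by
    ext H; simp [Set.mem_pi]
  rw [this]
  simp only [Measure.pi_pi, Fintype.prod_prod_type]

lemma measurePreserving_curry (m ι : Type*) [Fintype m] [Fintype ι] :
    MeasurePreserving (fun (h : m × ι → ℂ) r c ↦ h (r, c)) (gaussianVec (m × ι))
      (gaussianMat m ι) :=
  (measurePreserving_uncurry m ι).symm (MeasurableEquiv.curry m ι ℂ).symm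

lemma measurePreserving_fadingLaw {k : ℕ} (m : ℕ) (n : Fin k → ℕ) :
    MeasurePreserving (fun (H : ∀ i : Fin k, Fin m → Fin (n i) → ℂ) r c ↦ H c.1 r c.2)
      (fadingLaw m n) (gaussianMat (Fin m) (Σ i, Fin (n i))) := by
  suffices MeasurePreserving (fun (H : ∀ i : Fin k, Fin m → Fin (n i) → ℂ)
      (p : Fin m × Σ i, Fin (n i)) ↦ H p.2.1 p.1 p.2.2) (fadingLaw m n) (gaussianVec _) from
    (measurePreserving_curry _ _).comp this
  have hm : Measurable fun (H : ∀ i : Fin k, Fin m → Fin (n i) → ℂ)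
      (p : Fin m × Σ i, Fin (n i)) ↦ H p.2.1 p.1 p.2.2 := by fun_prop
  refine ⟨hm, (Measure.pi_eq fun s hs ↦ ?_).symm⟩
  rw [Measure.map_apply hm (.univ_pi hs)]
  have : (fun (H : ∀ i : Fin k, Fin m → Fin (n i) → ℂ)
      (p : Fin m × Σ i, Fin (n i)) ↦ H p.2.1 p.1 p.2.2) ⁻¹' Set.univ.pi s =
      Set.univ.pi fun i ↦ Set.univ.pi fun r ↦ Set.univ.pi fun c ↦ s (r, ⟨i, c⟩) := by
    ext H
    simp only [Set.mem_preimage, Set.mem_pi, Set.mem_univ, true_imp_iff, Prod.forall,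
      Sigma.forall]
    exact forall_comm
  rw [this, fadingLaw]
  simp only [Measure.pi_pi, Fintype.prod_prod_type, Fintype.prod_sigma]
  exact Finset.prod_comm

/-- On the vector of all entries, left multiplication by `U` is the unitary `U ⊗ 1`, so the
invariance of Gaussian vectors applies. -/
lemma measurePreserving_unitary_mul {m ι : Type*} [Fintype m] [DecidableEq m] [Fintype ι]
    {U : Matrix m m ℂ} (hU : U ∈ Matrix.unitaryGroup m ℂ) :
    MeasurePreserving (fun (H : m → ι → ℂ) r c ↦ (U * Matrix.of H) r c) (gaussianMat m ι)
      (gaussianMat m ι) := by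
  classical
  have hU' : U ⊗ₖ (1 : Matrix ι ι ℂ) ∈ Matrix.unitaryGroup (m × ι) ℂ :=
    Matrix.kronecker_mem_unitary hU (one_mem _)
  have := ((measurePreserving_curry m ι).comp (measurePreserving_mulVec hU')).comp
    (measurePreserving_uncurry m ι)
  convert this using 1
  ext H r c
  simp [Matrix.mulVec, dotProduct, Fintype.sum_prod_type, Matrix.mul_apply, Matrix.one_apply]

lemma measurePreserving_mul_unitary {k m : ℕ} {n : Fin k → ℕ}
    {U : ∀ i, Matrix (Fin (n i)) (Fin (n i)) ℂ}
    (hU : ∀ i, U i ∈ Matrix.unitaryGroup (Fin (n i)) ℂ) :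
    MeasurePreserving (fun (H : ∀ i : Fin k, Fin m → Fin (n i) → ℂ) i r ↦ H i r ᵥ* U i)
      (fadingLaw m n) (fadingLaw m n) :=
  measurePreserving_pi _ _ fun i ↦ measurePreserving_pi _ _ fun _ ↦ measurePreserving_vecMul (hU i)

/-! ### Determinants: dependence on one row, and bounds. -/

/-- A Gram matrix is the sum of the rank-one contributions of the rows, so the contribution of row
`r` splits off. -/
lemma conjTranspose_mul_self_updateRow {m ι : Type*} [Fintype m] [DecidableEq m]
    (X : Matrix m ι ℂ) (r : m) (y : ι → ℂ) :
    (Matrix.updateRow X r y)ᴴ * Matrix.updateRow X r y =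
      (Matrix.updateRow X r 0)ᴴ * Matrix.updateRow X r 0 +
        (Matrix.replicateRow Unit y)ᴴ * Matrix.replicateRow Unit y := by
  ext i j
  simp only [Matrix.mul_apply, Matrix.conjTranspose_apply, Matrix.add_apply, Matrix.updateRow_apply,
    Matrix.replicateRow_apply]
  rw [← Finset.add_sum_erase _ _ (Finset.mem_univ r), ← Finset.add_sum_erase Finset.univ
    (fun x ↦ star (if x = r then (0 : ι → ℂ) i else X x i) * _) (Finset.mem_univ r)]
  simp only [if_true, Pi.zero_apply, star_zero, zero_mul, zero_add, Finset.univ_unique,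
    Finset.sum_const, Finset.card_singleton, one_smul]
  rw [add_comm]
  congr 1
  refine Finset.sum_congr rfl fun x hx ↦ ?_
  simp only [if_neg (Finset.ne_of_mem_erase hx)]

lemma posDef_one_add {m ι : Type*} [DecidableEq m] [Fintype m] [Fintype ι] {K : Matrix ι ι ℂ}
    (hK : K.PosSemidef) (X : Matrix m ι ℂ) : (1 + X * K * Xᴴ).PosDef :=
  Matrix.PosDef.one.add_posSemidef (hK.mul_mul_conjTranspose_same X)

lemma exists_spectral_decomposition {ι : Type*} [Fintype ι] [DecidableEq ι] {M : Matrix ι ι ℂ}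
    (hM : M.PosSemidef) :
    ∃ Q ∈ Matrix.unitaryGroup ι ℂ, ∃ l : ι → ℝ, (∀ j, 0 ≤ l j) ∧
      M = Q * Matrix.diagonal (fun j ↦ (l j : ℂ)) * Qᴴ := by
  refine ⟨hM.1.eigenvectorUnitary, hM.1.eigenvectorUnitary.2, hM.1.eigenvalues,
    hM.eigenvalues_nonneg, ?_⟩
  conv_lhs => rw [hM.1.spectral_theorem, Unitary.conjStarAlgAut_apply]
  rfl

/-- A positive semidefinite quadratic form is a weighted sum of squared absolute values in
suitable unitary coordinates. -/
lemma exists_diag_quadratic {ι : Type*} [Fintype ι] [DecidableEq ι] {M : Matrix ι ι ℂ}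
    (hM : M.PosSemidef) :
    ∃ Q ∈ Matrix.unitaryGroup ι ℂ, ∃ l : ι → ℝ, (∀ j, 0 ≤ l j) ∧ ∀ y : ι → ℂ,
      y ⬝ᵥ M *ᵥ star y = ((∑ j, l j * Complex.normSq ((y ᵥ* Q) j) : ℝ) : ℂ) := by
  obtain ⟨Q, hQ, l, hl, rfl⟩ := exists_spectral_decomposition hM
  refine ⟨Q, hQ, l, hl, fun y ↦ ?_⟩
  rw [← Matrix.mulVec_mulVec, ← Matrix.mulVec_mulVec, Matrix.dotProduct_mulVec,
    ← Matrix.star_vecMul]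
  push_cast
  simp only [dotProduct, Matrix.mulVec_diagonal, Pi.star_apply]
  refine Finset.sum_congr rfl fun j _ ↦ ?_
  rw [Complex.normSq_eq_conj_mul_self, ← starRingEnd_apply]
  ring

lemma exists_eq_conjTranspose_mul_self {ι : Type*} [Fintype ι] [DecidableEq ι] {K : Matrix ι ι ℂ}
    (hK : K.PosSemidef) : ∃ B : Matrix ι ι ℂ, K = Bᴴ * B := by
  obtain ⟨Q, hQ, l, hl, rfl⟩ := exists_spectral_decomposition hK
  refine ⟨Matrix.diagonal (fun j ↦ (√(l j) : ℂ)) * Qᴴ, ?_⟩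
  rw [Matrix.conjTranspose_mul, Matrix.conjTranspose_conjTranspose,
    Matrix.diagonal_conjTranspose, Matrix.mul_assoc, Matrix.mul_assoc, ← Matrix.mul_assoc
    (Matrix.diagonal _) (Matrix.diagonal _), Matrix.diagonal_mul_diagonal]
  congr 3
  ext j
  simp [← Complex.ofReal_mul, Real.mul_self_sqrt (hl j)]

/-- As a function of one row, the determinant `det (1 + X K Xᴴ)` is an affine function of the
squared absolute values of the row's entries in suitable unitary coordinates. -/
lemma exists_det_updateRow {m ι : Type*} [Fintype m] [DecidableEq m] [Fintype ι] [DecidableEq ι]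
    {K : Matrix ι ι ℂ} (hK : K.PosSemidef) (X : Matrix m ι ℂ) (r : m) :
    ∃ Q ∈ Matrix.unitaryGroup ι ℂ, ∃ l : ι → ℝ, (∀ j, 0 ≤ l j) ∧ ∃ a : ℝ, 0 < a ∧
      ∀ y : ι → ℂ, (Matrix.det (1 + Matrix.updateRow X r y * K * (Matrix.updateRow X r y)ᴴ)).re =
        a * (1 + ∑ j, l j * Complex.normSq ((y ᵥ* Q) j)) := by
  obtain ⟨B, hB⟩ := exists_eq_conjTranspose_mul_self hK
  set X₀ := Matrix.updateRow X r 0 with hX₀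
  -- With `K = Bᴴ B`, Sylvester's identity makes the determinant that of `1 + B Xᴴ X Bᴴ`. Here `C`
  -- is the part from the rows other than `r`, and row `y` adds a rank-one term. The matrix
  -- determinant lemma gives `det C * (1 + y Bᴴ C⁻¹ B yᴴ)`, so `a = det C`, and `Q` diagonalizes `Bᴴ
  -- C⁻¹ B`.
  set C := 1 + B * (X₀ᴴ * X₀) * Bᴴ with hC
  have hCpos : C.PosDef := posDef_one_add (Matrix.posSemidef_conjTranspose_mul_self X₀) B
  obtain ⟨Q, hQ, l, hl, hq⟩ := exists_diag_quadratic (hCpos.inv.posSemidef.conjTranspose_mul_mul_same B)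
  obtain ⟨a, ha, haC⟩ := RCLike.pos_iff_exists_ofReal.1 hCpos.det_pos
  refine ⟨Q, hQ, l, hl, a, ha, fun y ↦ ?_⟩
  have h1 : Matrix.det (1 + Matrix.updateRow X r y * K * (Matrix.updateRow X r y)ᴴ) =
      Matrix.det (C + (Matrix.replicateRow Unit y * Bᴴ)ᴴ * (Matrix.replicateRow Unit y * Bᴴ)) := by
    rw [hB, show Matrix.updateRow X r y * (Bᴴ * B) * (Matrix.updateRow X r y)ᴴ =
      (Matrix.updateRow X r y * Bᴴ) * (B * (Matrix.updateRow X r y)ᴴ) by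
        simp only [Matrix.mul_assoc], Matrix.det_one_add_mul_comm, Matrix.mul_assoc,
      ← Matrix.mul_assoc (Matrix.updateRow X r y)ᴴ, conjTranspose_mul_self_updateRow, ← hX₀, hC]
    simp only [Matrix.conjTranspose_mul, Matrix.conjTranspose_conjTranspose, Matrix.mul_assoc,
      Matrix.mul_add, Matrix.add_mul, add_assoc]
  have h2 : (1 + Matrix.replicateRow Unit y * Bᴴ * C⁻¹ * (Matrix.replicateRow Unit y * Bᴴ)ᴴ).det =
      1 + y ⬝ᵥ (Bᴴ * C⁻¹ * B) *ᵥ star y := by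
    rw [Matrix.det_unique, Matrix.add_apply, Matrix.one_apply_eq, Matrix.conjTranspose_mul,
      Matrix.conjTranspose_conjTranspose, Matrix.dotProduct_mulVec]
    congr 1
    rw [show Matrix.replicateRow Unit y * Bᴴ * C⁻¹ * (B * (Matrix.replicateRow Unit y)ᴴ) =
      Matrix.replicateRow Unit y * (Bᴴ * C⁻¹ * B) * (Matrix.replicateRow Unit y)ᴴ by
        simp only [Matrix.mul_assoc]]
    rfl
  rw [h1, Matrix.det_add_mul _ _ hCpos.det_pos.ne'.isUnit, h2, hq, ← haC]
  simp only [RCLike.ofReal_eq_complex_ofReal]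
  norm_cast

/-- Both bounds are read off the eigenvalues, the upper one from `log (1 + x) ≤ x`. Nonnegativity
allows passing to `[0, ∞]`-valued integrals; the trace bound makes them finite. -/
lemma log_det_one_add_bounds {m : Type*} [Fintype m] [DecidableEq m] {M : Matrix m m ℂ}
    (hM : M.PosSemidef) :
    0 ≤ Real.log (Matrix.det (1 + M)).re ∧ Real.log (Matrix.det (1 + M)).re ≤ M.trace.re := by
  obtain ⟨Q, hQ, l, hl, rfl⟩ := exists_spectral_decomposition hM
  have hQQ : Q * Qᴴ = 1 := Matrix.mem_unitaryGroup_iff.1 hQ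
  have hQQ' : Qᴴ * Q = 1 := Matrix.mem_unitaryGroup_iff'.1 hQ
  have h1 : Matrix.det (1 + Q * Matrix.diagonal (fun j ↦ (l j : ℂ)) * Qᴴ) =
      ((∏ i, (1 + l i) : ℝ) : ℂ) := by
    rw [Matrix.mul_assoc, Matrix.det_one_add_mul_comm, Matrix.mul_assoc, hQQ', Matrix.mul_one,
      ← Matrix.diagonal_one, Matrix.diagonal_add, Matrix.det_diagonal]
    push_cast; rfl
  have h3 : (Q * Matrix.diagonal (fun j ↦ (l j : ℂ)) * Qᴴ).trace.re = ∑ i, l i := by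
    rw [Matrix.trace_mul_cycle, hQQ', Matrix.one_mul, Matrix.trace_diagonal]
    simp
  rw [h1, Complex.ofReal_re, h3, Real.log_prod (fun i _ ↦ by have := hl i; positivity)]
  exact ⟨Finset.sum_nonneg fun i _ ↦ Real.log_nonneg (by linarith [hl i]),
    Finset.sum_le_sum fun i _ ↦ by
      have := Real.log_le_sub_one_of_pos (x := 1 + l i) (by linarith [hl i])
      linarith⟩

/-! ### Domination of Gram matrices and contractions. -/

/-- Douglas' factorization: a linear map dominated by another one factors through it by a
contraction. -/
lemma exists_contraction_comp {E F : Type*} [NormedAddCommGroup E] [InnerProductSpace ℂ E]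
    [NormedAddCommGroup F] [InnerProductSpace ℂ F] [FiniteDimensional ℂ F] (a b : E →ₗ[ℂ] F)
    (h : ∀ x, ‖b x‖ ≤ ‖a x‖) : ∃ T : F →ₗ[ℂ] F, (∀ y, ‖T y‖ ≤ ‖y‖) ∧ b = T ∘ₗ a := by
  obtain ⟨g, hg⟩ := a.rangeRestrict.exists_rightInverse_of_surjective a.range_rangeRestrict
  have hg' : ∀ y, a (g y) = y := fun y ↦ congrArg Subtype.val (LinearMap.congr_fun hg y)
  -- `T` projects orthogonally onto the range of `a`, lifts by a linear section `g` of `a`, and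
  -- applies `b`.
  refine ⟨b ∘ₗ g ∘ₗ (a.range.orthogonalProjectionOnto : F →ₗ[ℂ] a.range), fun y ↦ ?_, ?_⟩
  · refine (h _).trans ?_
    simp only [LinearMap.comp_apply, hg']
    exact a.range.norm_orthogonalProjectionOnto_apply_le y
  · ext x
    have h1 : a.range.orthogonalProjectionOnto (a x) = ⟨a x, a.mem_range_self x⟩ :=
      a.range.orthogonalProjectionOnto_mem_subspace_eq_self ⟨a x, a.mem_range_self x⟩
    -- The choice of section is harmless: the kernel of `a` lies in the kernel of `b`, by
    -- domination.
    have h2 : b (x - g ⟨a x, a.mem_range_self x⟩) = 0 := by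
      refine norm_le_zero_iff.1 ((h _).trans ?_)
      rw [map_sub, hg', sub_self, norm_zero]
    rw [map_sub, sub_eq_zero] at h2
    simpa [h1] using h2

/-- The singular value decomposition of a contraction. -/
lemma exists_singular_bases {m : ℕ} (T : EuclideanSpace ℂ (Fin m) →ₗ[ℂ] EuclideanSpace ℂ (Fin m))
    (hT : ∀ y, ‖T y‖ ≤ ‖y‖) :
    ∃ (v e : OrthonormalBasis (Fin m) ℂ (EuclideanSpace ℂ (Fin m))) (t : Fin m → ℝ),
      (∀ i, 0 ≤ t i ∧ t i ≤ 1) ∧ ∀ i, T (v i) = (t i : ℂ) • e i := by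
  have hS : (T.adjoint ∘ₗ T).IsSymmetric := T.isSymmetric_adjoint_comp_self
  have hn : Module.finrank ℂ (EuclideanSpace ℂ (Fin m)) = m := finrank_euclideanSpace_fin
  have hn' : Module.finrank ℂ (EuclideanSpace ℂ (Fin m)) = Fintype.card (Fin m) := by simp
  set v := hS.eigenvectorBasis hn
  have hf : Pairwise fun i j ↦ inner ℂ (T (v i)) (T (v j)) = 0 := fun i j hij ↦ by
    beta_reduce
    rw [← LinearMap.adjoint_inner_right, ← LinearMap.comp_apply, hS.apply_eigenvectorBasis,
      inner_smul_right, v.orthonormal.2 hij, mul_zero]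
  -- The images `T (v i)` of the eigenvectors of `T* T` are already orthogonal, so Gram–Schmidt
  -- merely normalizes the nonzero ones and completes the basis where `T (v i) = 0`; there the
  -- singular value is `0`.
  refine ⟨v, InnerProductSpace.gramSchmidtOrthonormalBasis hn' fun i ↦ T (v i), fun i ↦ ‖T (v i)‖,
    fun i ↦ ⟨norm_nonneg _, (hT _).trans_eq (v.orthonormal.1 i)⟩, fun i ↦ ?_⟩
  by_cases h0 : T (v i) = 0
  · simp [h0]
  · rw [InnerProductSpace.gramSchmidtOrthonormalBasis_apply_of_orthogonal hn' hf h0, smul_smul]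
    have : (‖T (v i)‖ : ℂ) ≠ 0 := by simpa using h0
    simp [this]

lemma mem_unitaryGroup_of_orthonormalBasis {m : ℕ}
    (v : OrthonormalBasis (Fin m) ℂ (EuclideanSpace ℂ (Fin m))) :
    (Matrix.of fun r i ↦ v i r) ∈ Matrix.unitaryGroup (Fin m) ℂ := by
  rw [Matrix.mem_unitaryGroup_iff']
  ext i j
  have := orthonormal_iff_ite.1 v.orthonormal i j
  simp only [PiLp.inner_apply, RCLike.inner_apply'] at this
  simpa [Matrix.mul_apply, Matrix.one_apply, Matrix.star_apply] using this

/-- If `BᴴB ≤ AᴴA`, then up to unitary transformations from the left, `B` arises from `A` by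
scaling its rows down. -/
lemma exists_eq_unitary_mul_diagonal {m : ℕ} {ι : Type*} [Fintype ι] [DecidableEq ι]
    {A B : Matrix (Fin m) ι ℂ} (h : (Aᴴ * A - Bᴴ * B).PosSemidef) :
    ∃ U ∈ Matrix.unitaryGroup (Fin m) ℂ, ∃ V ∈ Matrix.unitaryGroup (Fin m) ℂ,
      ∃ t : Fin m → ℝ, (∀ i, 0 ≤ t i ∧ t i ≤ 1) ∧
        B = U * (Matrix.diagonal (fun i ↦ (t i : ℂ)) * (V * A)) := by
  have hnorm : ∀ (M : Matrix (Fin m) ι ℂ) (x : EuclideanSpace ℂ ι),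
      ((‖Matrix.toEuclideanLin M x‖ ^ 2 : ℝ) : ℂ) = star x.ofLp ⬝ᵥ (Mᴴ * M) *ᵥ x.ofLp := by
    intro M x
    have := inner_self_eq_norm_sq_to_K (𝕜 := ℂ) (Matrix.toEuclideanLin M x)
    push_cast
    refine this.symm.trans ?_
    rw [EuclideanSpace.inner_eq_star_dotProduct, Matrix.ofLp_toLpLin, Matrix.toLin'_apply, dotProduct_comm,
      Matrix.star_mulVec, ← Matrix.dotProduct_mulVec, Matrix.mulVec_mulVec]
  obtain ⟨T, hT, hTab⟩ := exists_contraction_comp (Matrix.toEuclideanLin A)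
    (Matrix.toEuclideanLin B) fun x ↦ by
      rw [← sq_le_sq₀ (norm_nonneg _) (norm_nonneg _), ← Complex.real_le_real, hnorm, hnorm,
        ← sub_nonneg, ← dotProduct_sub, ← Matrix.sub_mulVec]
      exact h.dotProduct_mulVec_nonneg _
  obtain ⟨v, e, t, ht, hve⟩ := exists_singular_bases T hT
  have hV := mem_unitaryGroup_of_orthonormalBasis v
  refine ⟨_, mem_unitaryGroup_of_orthonormalBasis e, _, Unitary.star_mem hV, t, ht, ?_⟩
  set W := Matrix.toEuclideanLin.symm T with hW
  have hBW : B = W * A := by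
    apply Matrix.toEuclideanLin.injective
    rw [hTab, Matrix.toLpLin_mul_same, hW, LinearEquiv.apply_symm_apply]
  have hWV : W * (Matrix.of fun r i ↦ v i r) =
      (Matrix.of fun r i ↦ e i r) * Matrix.diagonal (fun i ↦ (t i : ℂ)) := by
    ext r i
    have h1 := congrArg (fun z : EuclideanSpace ℂ (Fin m) ↦ z r) (hve i)
    have h2 : T = Matrix.toEuclideanLin W := by rw [hW, LinearEquiv.apply_symm_apply]
    rw [h2] at h1
    simp only [Matrix.ofLp_toLpLin, Matrix.toLin'_apply, PiLp.smul_apply, smul_eq_mul] at h1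
    rw [Matrix.mul_diagonal, Matrix.of_apply, mul_comm, ← h1]
    rfl
  rw [← Matrix.mul_assoc, ← Matrix.mul_assoc, ← hWV, Matrix.mul_assoc W,
    Matrix.mem_unitaryGroup_iff.1 hV, Matrix.mul_one, hBW]

/-! ### Monotonicity and finiteness of the expected log-determinant. -/

/-- `log det (1 + X K Xᴴ)` as an extended nonnegative real. -/
noncomputable def logDet {m ι : Type*} [Fintype m] [DecidableEq m] [Fintype ι]
    (K : Matrix ι ι ℂ) (X : m → ι → ℂ) : ℝ≥0∞ :=
  ENNReal.ofReal (Real.log (Matrix.det (1 + Matrix.of X * K * (Matrix.of X)ᴴ)).re)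

section
variable {m ι : Type*} [Fintype m] [DecidableEq m] [Fintype ι]

lemma measurable_log_det (K : Matrix ι ι ℂ) : Measurable fun X : m → ι → ℂ ↦
    Real.log (Matrix.det (1 + Matrix.of X * K * (Matrix.of X)ᴴ)).re := by
  have h1 : Continuous fun X : m → ι → ℂ ↦ (Matrix.of X : Matrix m ι ℂ) := continuous_id
  have h2 : Continuous fun X : m → ι → ℂ ↦ (1 + Matrix.of X * K * (Matrix.of X)ᴴ : Matrix m m ℂ) :=
    continuous_const.add ((h1.matrix_mul continuous_const).matrix_mul h1.matrix_conjTranspose)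
  exact Real.measurable_log.comp (Complex.continuous_re.comp h2.matrix_det).measurable

lemma measurable_logDet (K : Matrix ι ι ℂ) : Measurable (logDet (m := m) K) :=
  (measurable_log_det K).ennreal_ofReal

/-- The expectation of `log det (1 + X K Xᴴ)` where `X` has independent complex Gaussian entries of
unit variance and mean `A`. -/
noncomputable def meanLogDet (K : Matrix ι ι ℂ) (A : m → ι → ℂ) : ℝ≥0∞ :=
  ∫⁻ H, logDet K (H + A) ∂gaussianMat m ι

lemma logDet_unitary_mul {U : Matrix m m ℂ} (hU : U ∈ Matrix.unitaryGroup m ℂ) (K : Matrix ι ι ℂ)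
    (X : m → ι → ℂ) : logDet K (U * Matrix.of X) = logDet K X := by
  unfold logDet
  have hUU : Uᴴ * U = 1 := Matrix.mem_unitaryGroup_iff'.1 hU
  have : Matrix.det (1 + U * Matrix.of X * K * (U * Matrix.of X)ᴴ) =
      Matrix.det (1 + Matrix.of X * K * (Matrix.of X)ᴴ) := by
    rw [Matrix.conjTranspose_mul, Matrix.mul_assoc U, Matrix.mul_assoc U,
      Matrix.det_one_add_mul_comm, ← Matrix.mul_assoc, Matrix.mul_assoc, hUU, Matrix.mul_one]
  exact congrArg (fun z : ℂ ↦ ENNReal.ofReal (Real.log z.re)) this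

lemma meanLogDet_unitary_mul {U : Matrix m m ℂ} (hU : U ∈ Matrix.unitaryGroup m ℂ)
    (K : Matrix ι ι ℂ) (A : m → ι → ℂ) : meanLogDet K (U * Matrix.of A) = meanLogDet K A := by
  obtain ⟨C, hC⟩ : ∃ C : m → ι → ℂ, C = U * Matrix.of A := ⟨_, rfl⟩
  rw [← hC]
  unfold meanLogDet
  rw [← (measurePreserving_unitary_mul hU).lintegral_comp
    (f := fun H ↦ logDet K (H + C)) ((measurable_logDet K).comp (measurable_add_const _))]
  refine lintegral_congr fun H ↦ ?_
  rw [← logDet_unitary_mul hU K (H + A)]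
  congr 1
  rw [hC]
  exact (Matrix.mul_add U (Matrix.of H) (Matrix.of A)).symm

/-- Monotonicity in the mean of a single row of the expectation of `logDet`. -/
lemma lintegral_logDet_update_mono [DecidableEq ι] {K : Matrix ι ι ℂ} (hK : K.PosSemidef)
    (X : m → ι → ℂ) (r : m) (a : ι → ℂ) {t : ℝ} (ht0 : 0 ≤ t) (ht1 : t ≤ 1) :
    ∫⁻ y, logDet K (Function.update X r (y + (t : ℂ) • a)) ∂gaussianVec ι ≤
      ∫⁻ y, logDet K (Function.update X r (y + a)) ∂gaussianVec ι := by
  obtain ⟨Q, hQ, l, hl, b, hb, hdet⟩ := exists_det_updateRow hK (Matrix.of X) r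
  set g : (ι → ℂ) → ℝ≥0∞ := fun z ↦
    ENNReal.ofReal (Real.log (b * (1 + ∑ j, l j * Complex.normSq (z j)))) with hg
  have hgm : Measurable g := by fun_prop
  have hlog : ∀ y, logDet K (Function.update X r y) = g (y ᵥ* Q) := fun y ↦
    congrArg (fun x : ℝ ↦ ENNReal.ofReal (Real.log x)) (hdet y)
  have hgmono : ∀ z w : ι → ℂ, (∀ j, |(z j).re| ≤ |(w j).re|) → (∀ j, |(z j).im| ≤ |(w j).im|) →
      g z ≤ g w := by
    intro z w hre him
    refine ENNReal.ofReal_le_ofReal (Real.log_le_log ?_ ?_)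
    · have : 0 ≤ ∑ j, l j * Complex.normSq (z j) :=
        Finset.sum_nonneg fun j _ ↦ mul_nonneg (hl j) (Complex.normSq_nonneg _)
      positivity
    · have : ∀ j, l j * Complex.normSq (z j) ≤ l j * Complex.normSq (w j) := fun j ↦ by
        refine mul_le_mul_of_nonneg_left ?_ (hl j)
        rw [Complex.normSq_apply, Complex.normSq_apply]
        exact add_le_add (abs_le_iff_mul_self_le.1 (hre j)) (abs_le_iff_mul_self_le.1 (him j))
      have := Finset.sum_le_sum fun j (_ : j ∈ Finset.univ) ↦ this j
      gcongr
  -- In the coordinates `y ᵥ* Q` the noise keeps its law, and the mean is absorbed into it: the row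
  -- becomes a product of translated scalar Gaussians.
  have hshift : ∀ c : ι → ℂ, ∫⁻ y, logDet K (Function.update X r (y + c)) ∂gaussianVec ι =
      ∫⁻ z, g z ∂Measure.pi fun j ↦ stdComplexGaussian.map (· + (c ᵥ* Q) j) := by
    intro c
    simp_rw [hlog, Matrix.add_vecMul]
    rw [(measurePreserving_vecMul hQ).lintegral_comp (f := fun z ↦ g (z + c ᵥ* Q))
      (hgm.comp (measurable_add_const _)), ← Measure.pi_map_pi (f := fun j x ↦ x + (c ᵥ* Q) j)
      (fun j ↦ by fun_prop), lintegral_map hgm (by fun_prop)]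
    rfl
  have hprob (c : ℂ) : IsProbabilityMeasure (stdComplexGaussian.map (· + c)) :=
    Measure.isProbabilityMeasure_map (by fun_prop)
  rw [hshift, hshift]
  refine lintegral_pi_mono _ _ hgm fun j x ↦ ?_
  have hgu : Measurable fun z ↦ g (Function.update x j z) := hgm.comp (measurable_update x)
  rw [lintegral_map hgu (by fun_prop), lintegral_map hgu (by fun_prop)]
  -- Since `t` is real, scaling commutes with `Q` and shrinks real and imaginary parts of each
  -- coordinate separately.
  have hscale : ∀ s : ℝ, |t * s| ≤ |s| := fun s ↦ by
    rw [abs_mul, abs_of_nonneg ht0]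
    exact mul_le_of_le_one_left (abs_nonneg _) ht1
  refine lintegral_stdComplexGaussian_add_mono hgu (fun z w hre him ↦ hgmono _ _ ?_ ?_) ?_ ?_
  · intro i
    rcases eq_or_ne i j with rfl | hij
    · simpa using hre
    · simp [hij]
  · intro i
    rcases eq_or_ne i j with rfl | hij
    · simpa using him
    · simp [hij]
  · rw [Matrix.smul_vecMul, Pi.smul_apply, smul_eq_mul, Complex.re_ofReal_mul]
    exact hscale _
  · rw [Matrix.smul_vecMul, Pi.smul_apply, smul_eq_mul, Complex.im_ofReal_mul]
    exact hscale _

/-- Rows are independent and the diagonal factor scales each separately, so the one-row comparison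
is applied row by row. -/
lemma meanLogDet_diagonal_mul_le [DecidableEq ι] {K : Matrix ι ι ℂ} (hK : K.PosSemidef)
    (A : m → ι → ℂ) {t : m → ℝ} (ht : ∀ i, 0 ≤ t i ∧ t i ≤ 1) :
    meanLogDet K (Matrix.diagonal (fun i ↦ (t i : ℂ)) * Matrix.of A) ≤ meanLogDet K A := by
  have hshift : ∀ C : m → ι → ℂ, meanLogDet K C =
      ∫⁻ X, logDet K X ∂Measure.pi fun r ↦ (gaussianVec ι).map (· + C r) := by
    intro C
    rw [← Measure.pi_map_pi (f := fun r x ↦ x + C r) (fun j ↦ by fun_prop),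
      lintegral_map (measurable_logDet K) (by fun_prop)]
    rfl
  have hprob (c : ι → ℂ) : IsProbabilityMeasure ((gaussianVec ι).map (· + c)) :=
    Measure.isProbabilityMeasure_map (by fun_prop)
  refine (hshift _).trans_le (le_of_le_of_eq ?_ (hshift A).symm)
  refine lintegral_pi_mono _ _ (measurable_logDet K) fun r X ↦ ?_
  have hu : Measurable fun y ↦ logDet K (Function.update X r y) :=
    (measurable_logDet K).comp (measurable_update X)
  rw [lintegral_map hu (by fun_prop), lintegral_map hu (by fun_prop)]
  convert lintegral_logDet_update_mono hK X r (A r) (ht r).1 (ht r).2 using 5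
  ext j
  simp [Matrix.diagonal_mul]

end

/-- Monotonicity of the mean mutual information in the Gram matrix of the LOS matrix. -/
lemma meanLogDet_mono {m : ℕ} {ι : Type*} [Fintype ι] [DecidableEq ι] {K : Matrix ι ι ℂ}
    (hK : K.PosSemidef) {A B : Matrix (Fin m) ι ℂ} (h : (Aᴴ * A - Bᴴ * B).PosSemidef) :
    meanLogDet K B ≤ meanLogDet K A := by
  obtain ⟨U, hU, V, hV, t, ht, rfl⟩ := exists_eq_unitary_mul_diagonal h
  exact (meanLogDet_unitary_mul hU K _).trans_le <|
    (meanLogDet_diagonal_mul_le hK (V * A) ht).trans_eq (meanLogDet_unitary_mul hV K A)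

lemma memLp_id_stdComplexGaussian : MemLp id 2 stdComplexGaussian := by
  have hmk : Measurable fun p : ℝ × ℝ ↦ (⟨p.1, p.2⟩ : ℂ) :=
    Complex.measurableEquivRealProd.symm.measurable
  rw [stdComplexGaussian, memLp_map_measure_iff (by fun_prop) hmk.aemeasurable]
  have h : MemLp (id : ℝ → ℝ) 2 (gaussianReal 0 (1 / 2)) := memLp_id_gaussianReal 2
  have h1 : MemLp (fun p : ℝ × ℝ ↦ (p.1 : ℂ)) 2
      ((gaussianReal 0 (1 / 2)).prod (gaussianReal 0 (1 / 2))) :=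
    (h.comp_measurePreserving measurePreserving_fst).ofReal
  have h2 : MemLp (fun p : ℝ × ℝ ↦ (p.2 : ℂ)) 2
      ((gaussianReal 0 (1 / 2)).prod (gaussianReal 0 (1 / 2))) :=
    (h.comp_measurePreserving measurePreserving_snd).ofReal
  refine (h1.add (h2.mul_const Complex.I)).ae_eq (ae_of_all _ fun p ↦ ?_)
  exact Complex.ext (by simp) (by simp)

/-- The trace bounding the log-determinant is quadratic in entries that are square integrable.
Finiteness is essential for returning to real rates, because `toReal` sends `∞` to `0`. -/
lemma meanLogDet_ne_top {m ι : Type*} [Fintype m] [DecidableEq m] [Fintype ι] {K : Matrix ι ι ℂ}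
    (hK : K.PosSemidef) (A : m → ι → ℂ) : meanLogDet K A ≠ ∞ := by
  have hX : ∀ r c, MemLp (fun H : m → ι → ℂ ↦ (H + A) r c) 2 (gaussianMat m ι) := fun r c ↦ by
    have h1 : MeasurePreserving (fun H : m → ι → ℂ ↦ H r c) (gaussianMat m ι) stdComplexGaussian :=
      (measurePreserving_eval (fun _ : ι ↦ stdComplexGaussian) c).comp
        (measurePreserving_eval (fun _ : m ↦ gaussianVec ι) r)
    exact (memLp_id_stdComplexGaussian.comp_measurePreserving h1).add (memLp_const (A r c))
  have hint : Integrable (fun H : m → ι → ℂ ↦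
      (Matrix.of (H + A) * K * (Matrix.of (H + A))ᴴ).trace.re) (gaussianMat m ι) := by
    refine Integrable.re (f := fun H : m → ι → ℂ ↦
      (Matrix.of (H + A) * K * (Matrix.of (H + A))ᴴ).trace) ?_
    simp only [Matrix.trace, Matrix.diag, Matrix.mul_apply, Matrix.conjTranspose_apply,
      Finset.sum_mul]
    refine integrable_finsetSum _ fun r _ ↦ integrable_finsetSum _ fun j _ ↦
      integrable_finsetSum _ fun i _ ↦ ?_
    exact ((hX r i).mul_const (K i j)).integrable_mul (hX r j).star
  refine ne_top_of_le_ne_top hint.lintegral_lt_top.ne (lintegral_mono fun H ↦ ?_)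
  exact ENNReal.ofReal_le_ofReal (log_det_one_add_bounds (hK.mul_mul_conjTranspose_same _)).2

/-! ### From the single Gaussian matrix back to the multiple-access channel. -/

section Channel
variable {k m : ℕ} {n : Fin k → ℕ}

/-- The block-diagonal input covariance matrix of the users in `S`. -/
noncomputable def jointCovariance (K : ∀ i, Matrix (Fin (n i)) (Fin (n i)) ℂ) (S : Finset (Fin k)) :
    Matrix (Σ i, Fin (n i)) (Σ i, Fin (n i)) ℂ :=
  Matrix.blockDiagonal' fun i ↦ if i ∈ S then K i else 0

/-- Users outside `S` are silenced by a zero covariance block, so every subset constraint takes the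
single-user form over the same full block row. -/
lemma blockRow_mul_jointCovariance (K : ∀ i, Matrix (Fin (n i)) (Fin (n i)) ℂ)
    (X : ∀ i, Matrix (Fin m) (Fin (n i)) ℂ) (S : Finset (Fin k)) :
    blockRow X * jointCovariance K S * (blockRow X)ᴴ = ∑ i ∈ S, X i * K i * (X i)ᴴ := by
  have h1 : blockRow X * jointCovariance K S =
      blockRow fun i ↦ X i * if i ∈ S then K i else 0 := by
    ext r ⟨i, c⟩
    simp only [Matrix.mul_apply, blockRow, jointCovariance, Matrix.of_apply, Fintype.sum_sigma]
    rw [Finset.sum_eq_single i]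
    · simp [Matrix.blockDiagonal'_apply]
    · intro j _ hj
      simp [Matrix.blockDiagonal'_apply, hj]
    · simp
  rw [h1]
  ext r s
  rw [Matrix.sum_apply]
  rw [Matrix.mul_apply, Fintype.sum_sigma]
  rw [← Finset.sum_subset (Finset.subset_univ S)]
  · refine Finset.sum_congr rfl fun i hi ↦ ?_
    rw [Matrix.mul_apply]
    simp [blockRow, hi]
  · intro i _ hi
    simp [blockRow, hi]

lemma posSemidef_jointCovariance {K : ∀ i, Matrix (Fin (n i)) (Fin (n i)) ℂ}
    (hK : ∀ i, (K i).PosSemidef) (S : Finset (Fin k)) : (jointCovariance K S).PosSemidef := by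
  have hK' (i : Fin k) : (if i ∈ S then K i else 0).PosSemidef := by
    split_ifs
    exacts [hK i, .zero]
  choose B hB using fun i ↦ exists_eq_conjTranspose_mul_self (hK' i)
  have : jointCovariance K S = (Matrix.blockDiagonal' B)ᴴ * Matrix.blockDiagonal' B := by
    rw [Matrix.blockDiagonal'_conjTranspose, ← Matrix.blockDiagonal'_mul]
    exact congrArg _ (funext hB)
  rw [this]
  exact Matrix.posSemidef_conjTranspose_mul_self _

lemma gaussianRate_eq_toReal {K : ∀ i, Matrix (Fin (n i)) (Fin (n i)) ℂ}
    (hK : ∀ i, (K i).PosSemidef) (D : ∀ i, Matrix (Fin m) (Fin (n i)) ℂ) (S : Finset (Fin k)) :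
    gaussianRate K D S = (meanLogDet (jointCovariance K S) (blockRow D)).toReal := by
  obtain ⟨A, hA⟩ : ∃ A : Fin m → (Σ i, Fin (n i)) → ℂ, A = blockRow D := ⟨_, rfl⟩
  have hmp := measurePreserving_fadingLaw m n
  have hmeas : Measurable fun H : Fin m → (Σ i, Fin (n i)) → ℂ ↦ Real.log (Matrix.det (1 +
      Matrix.of (H + A) * jointCovariance K S * (Matrix.of (H + A))ᴴ)).re :=
    (measurable_log_det (jointCovariance K S)).comp (measurable_add_const A)
  have h1 : gaussianRate K D S = ∫ H, Real.log (Matrix.det (1 +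
      Matrix.of (H + A) * jointCovariance K S * (Matrix.of (H + A))ᴴ)).re
        ∂gaussianMat (Fin m) (Σ i, Fin (n i)) := by
    rw [← hmp.map_eq, integral_map hmp.measurable.aemeasurable hmeas.aestronglyMeasurable]
    refine integral_congr_ae (ae_of_all _ fun H ↦ ?_)
    simp only [← blockRow_mul_jointCovariance, hA]
    rfl
  rw [h1, integral_eq_lintegral_of_nonneg_ae (ae_of_all _ fun H ↦ (log_det_one_add_bounds
    ((posSemidef_jointCovariance hK S).mul_mul_conjTranspose_same _)).1) hmeas.aestronglyMeasurable, ← hA]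
  rfl

/-- Monotonicity of the mean mutual information in the Gram matrix of the LOS matrices. -/
lemma gaussianRate_mono {K : ∀ i, Matrix (Fin (n i)) (Fin (n i)) ℂ}
    (hK : ∀ i, (K i).PosSemidef) {A B : ∀ i, Matrix (Fin m) (Fin (n i)) ℂ}
    (h : ((blockRow A)ᴴ * blockRow A - (blockRow B)ᴴ * blockRow B).PosSemidef)
    (S : Finset (Fin k)) : gaussianRate K B S ≤ gaussianRate K A S := by
  have hKS := posSemidef_jointCovariance hK S
  rw [gaussianRate_eq_toReal hK, gaussianRate_eq_toReal hK]
  exact ENNReal.toReal_mono (meanLogDet_ne_top hKS _) (meanLogDet_mono hKS h)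

/-- Rotating the inputs amounts to rotating the LOS matrices. -/
lemma gaussianRate_conj_unitary (K : ∀ i, Matrix (Fin (n i)) (Fin (n i)) ℂ)
    {U : ∀ i, Matrix (Fin (n i)) (Fin (n i)) ℂ}
    (hU : ∀ i, U i ∈ Matrix.unitaryGroup (Fin (n i)) ℂ) (D : ∀ i, Matrix (Fin m) (Fin (n i)) ℂ)
    (S : Finset (Fin k)) :
    gaussianRate (fun i ↦ U i * K i * (U i)ᴴ) D S = gaussianRate K (fun i ↦ D i * U i) S := by
  have hmp := measurePreserving_mul_unitary (m := m) hU
  have hmeas : Measurable fun H : ∀ i : Fin k, Fin m → Fin (n i) → ℂ ↦ Real.log (Matrix.det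
      ((1 : Matrix (Fin m) (Fin m) ℂ) + ∑ i ∈ S, (Matrix.of (H i) + D i * U i) * K i *
        (Matrix.of (H i) + D i * U i)ᴴ)).re := by
    have h1 : ∀ i, Continuous fun H : ∀ i : Fin k, Fin m → Fin (n i) → ℂ ↦
        (Matrix.of (H i) + D i * U i : Matrix (Fin m) (Fin (n i)) ℂ) := fun i ↦
      (continuous_apply i).add continuous_const
    have h2 : Continuous fun H : ∀ i : Fin k, Fin m → Fin (n i) → ℂ ↦
        ((1 : Matrix (Fin m) (Fin m) ℂ) + ∑ i ∈ S, (Matrix.of (H i) + D i * U i) * K i *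
        (Matrix.of (H i) + D i * U i)ᴴ) :=
      continuous_const.add (continuous_finsetSum _ fun i _ ↦
        ((h1 i).matrix_mul continuous_const).matrix_mul (h1 i).matrix_conjTranspose)
    exact Real.measurable_log.comp (Complex.continuous_re.comp h2.matrix_det).measurable
  unfold gaussianRate
  conv_rhs => rw [← hmp.map_eq]
  rw [integral_map hmp.measurable.aemeasurable hmeas.aestronglyMeasurable]
  refine integral_congr_ae (ae_of_all _ fun H ↦ ?_)
  -- The factors `U i` are absorbed into `H i + D i`; the rotated fading matrix has the law of the
  -- original one.
  have : ∀ i, (Matrix.of (H i) + D i) * (U i * K i * (U i)ᴴ) * (Matrix.of (H i) + D i)ᴴ =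
      (Matrix.of (fun r ↦ H i r ᵥ* U i) + D i * U i) * K i *
        (Matrix.of (fun r ↦ H i r ᵥ* U i) + D i * U i)ᴴ := by
    intro i
    have : Matrix.of (fun r ↦ H i r ᵥ* U i) = Matrix.of (H i) * U i := rfl
    rw [this, ← Matrix.add_mul, Matrix.conjTranspose_mul]
    simp only [Matrix.mul_assoc]
  simp only [this]

end Channel
end RicianMAC

open scoped Matrix ComplexOrder in
theorem corollary3 {k m : ℕ} {n : Fin k → ℕ} (E : Fin k → ℝ)
    (D D' : ∀ i, Matrix (Fin m) (Fin (n i)) ℂ)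
    (hD : ∃ U : ∀ i, Matrix (Fin (n i)) (Fin (n i)) ℂ,
      (∀ i, U i ∈ Matrix.unitaryGroup (Fin (n i)) ℂ) ∧
      ((RicianMAC.blockRow fun i => D i * U i)ᴴ * (RicianMAC.blockRow fun i => D i * U i) -
        (RicianMAC.blockRow D')ᴴ * RicianMAC.blockRow D').PosSemidef) :
    RicianMAC.capacityRegion E D' ⊆ RicianMAC.capacityRegion E D := by
  obtain ⟨U, hU, h⟩ := hD
  rintro R ⟨K, hK, hR⟩
  -- The rotated covariances make the LOS matrices `D i * U i` appear, to which the Gram hypothesis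
  -- applies.
  refine ⟨fun i ↦ U i * K i * (U i)ᴴ, fun i ↦ ⟨(hK i).1.mul_mul_conjTranspose_same _, ?_⟩,
    fun S ↦ ?_⟩
  · have : (U i)ᴴ * U i = 1 := Matrix.mem_unitaryGroup_iff'.1 (hU i)
    rw [Matrix.trace_mul_cycle, this, Matrix.one_mul]
    exact (hK i).2
  · rw [RicianMAC.gaussianRate_conj_unitary K hU]
    exact (hR S).trans (RicianMAC.gaussianRate_mono (fun i ↦ (hK i).1) h S)
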